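/- All graphs are finite and simple. For an integer $k\ge 2$, a multiset $\mathscr{P}$ of paths in a graph $G$ is a \emph{$k$-rainbow separating path system} if its elements can be colored with $k$ colors so that for every two distinct edges $e_1,e_2$ of $G$ there exist $P_1,P_2\in\mathscr{P}$ of distinct colors such that $P_1$ contains $e_1$ but not $e_2$, and $P_2$ contains $e_2$ but not $e_1$. Let $c_k(G)$ denote the smallest cardinality of a $k$-rainbow separating path system of $G$. A class $\Sigma$ of trees is \emph{pathy} if the number of vertices of degree at least $3$ of its members on $n$ vertices is $o(n)$, i.e. there is a function $b:\mathbb{N}\to\mathbb{R}$ with $b(n)=o(n)$ such that every $T\in\Sigma$ on $n$ vertices has at most $b(n)$ vertices of degree at least $3$. \textbf{Theorem.} (1) If $T$ is a tree on $n$ vertices that is not a path, then $c_k(T)\le n-1$ for every $k\ge 4$. (2) For pathy classes of trees this bound is tight up to a sublinear error: for every pathy class $\Sigma$ of trees there is a function $g:\mathbb{N}\to\mathbb{R}$ with $g(n)=o(n)$ such that $c_k(T)\ge n-1-g(n)$ for every $k\ge 4$ and every $T\in\Sigma$ on $n$ vertices. -/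

import Mathlib

open Filter Asymptotics

namespace RainbowSep

/-- A path of `G`: two end vertices and a walk between them without repeated vertices. A path and
its reversal have the same edges, so keeping both does not affect any notion below. -/
abbrev GraphPath {V : Type*} (G : SimpleGraph V) : Type _ :=
  Σ u v : V, G.Path u v

/-- The edge `e` lies on the path `P`. -/
def GraphPath.HasEdge {V : Type*} {G : SimpleGraph V} (P : GraphPath G) (e : Sym2 V) : Prop :=
  e ∈ P.2.2.1.edges

/-- A multiset `P` of paths of `G` is a `k`-rainbow separating path system: its members can be
coloured with `k` colours (`Q` is the coloured multiset; equal members may get different colours)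
so that any two distinct edges `e`, `f` lie on two members of distinct colours, one containing `e`
and not `f`, the other containing `f` and not `e`. -/
def IsRSPS {V : Type*} (G : SimpleGraph V) (k : ℕ) (P : Multiset (GraphPath G)) : Prop :=
  ∃ Q : Multiset (GraphPath G × Fin k), Q.map Prod.fst = P ∧
    ∀ e ∈ G.edgeSet, ∀ f ∈ G.edgeSet, e ≠ f →
      ∃ x ∈ Q, ∃ y ∈ Q, x.2 ≠ y.2 ∧
        (x.1.HasEdge e ∧ ¬ x.1.HasEdge f) ∧ (y.1.HasEdge f ∧ ¬ y.1.HasEdge e)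

/-- The `k`-rainbow separation number `c_k(G)`: the smallest cardinality of a `k`-rainbow
separating path system of `G`. -/
noncomputable def rainbowSepNumber {V : Type*} (G : SimpleGraph V) (k : ℕ) : ℕ :=
  sInf {m : ℕ | ∃ P : Multiset (GraphPath G), IsRSPS G k P ∧ P.card = m}

/-- For at least two colours the minimum in `rainbowSepNumber` is attained. -/
theorem exists_isRSPS_card_eq {V : Type*} [Finite V] (G : SimpleGraph V) {k : ℕ} (hk : 2 ≤ k) :
    ∃ P : Multiset (GraphPath G), IsRSPS G k P ∧ P.card = rainbowSepNumber G k := by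
  classical
  have key : ∀ e : G.edgeSet, ∃ P : GraphPath G, ∀ f : Sym2 V, P.HasEdge f ↔ f = e := by
    rintro ⟨e, he⟩
    induction e using Sym2.ind with
    | _ a b =>
      have hab : G.Adj a b := he
      refine ⟨⟨a, b, SimpleGraph.Path.singleton hab⟩, fun f => ?_⟩
      simp [GraphPath.HasEdge, SimpleGraph.Path.singleton]
  choose p hp using key
  have : Fintype G.edgeSet := Fintype.ofFinite _
  let Q : Multiset (GraphPath G × Fin k) :=
    (Finset.univ : Finset (G.edgeSet × Fin k)).val.map fun z => (p z.1, z.2)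
  have hne : {m : ℕ | ∃ P : Multiset (GraphPath G), IsRSPS G k P ∧ P.card = m}.Nonempty := by
    refine ⟨_, Q.map Prod.fst, ⟨Q, rfl, fun e he f hf hef => ?_⟩, rfl⟩
    refine ⟨(p ⟨e, he⟩, ⟨0, by omega⟩), ?_, (p ⟨f, hf⟩, ⟨1, by omega⟩), ?_, ?_, ?_, ?_⟩
    · exact Multiset.mem_map.2 ⟨(⟨e, he⟩, ⟨0, by omega⟩), by simp, rfl⟩
    · exact Multiset.mem_map.2 ⟨(⟨f, hf⟩, ⟨1, by omega⟩), by simp, rfl⟩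
    · simp
    · exact ⟨(hp _ _).2 rfl, fun h => hef ((hp _ _).1 h).symm⟩
    · exact ⟨(hp _ _).2 rfl, fun h => hef ((hp _ _).1 h)⟩
  exact Nat.sInf_mem hne

/-- The finite graph `G` is a path (on any number of vertices, one included). -/
def IsPathGraph {V : Type*} [Fintype V] (G : SimpleGraph V) : Prop :=
  Nonempty (G ≃g SimpleGraph.pathGraph (Fintype.card V))

open Classical in
/-- The number of vertices of degree at least `3`. -/
noncomputable def numBranchVertices {V : Type*} [Fintype V] (G : SimpleGraph V) : ℕ :=
  (Finset.univ.filter fun v : V => 3 ≤ G.degree v).card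

/-- A class of finite graphs, given as a family `T i`, is a pathy class of trees: every member is
a tree, and the members on `n` vertices have `o(n)` vertices of degree at least `3`. -/
def IsPathyTreeClass {ι : Type*} {V : ι → Type*} [∀ i, Fintype (V i)]
    (T : ∀ i, SimpleGraph (V i)) : Prop :=
  (∀ i, (T i).IsTree) ∧
    ∃ b : ℕ → ℝ, b =o[atTop] (fun n : ℕ => (n : ℝ)) ∧
      ∀ i, (numBranchVertices (T i) : ℝ) ≤ b (Fintype.card (V i))

end RainbowSep

namespace RainbowSep

/-- `p` and `δ` are the parent map and the depth function of the tree `T` rooted at `r`. -/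
structure IsRooting {V : Type*} (T : SimpleGraph V) (r : V) (p : V → V) (δ : V → ℕ) : Prop where
  depth_root : δ r = 0
  adj : ∀ v, v ≠ r → T.Adj v (p v)
  depth : ∀ v, v ≠ r → δ v = δ (p v) + 1
  cover : ∀ v w, T.Adj v w → (v ≠ r ∧ p v = w) ∨ (w ≠ r ∧ p w = v)

theorem exists_isRooting {V : Type*} {T : SimpleGraph V} (hT : T.IsTree) (r : V) :
    ∃ p δ, IsRooting T r p δ := by
  choose f hf hf' using (hT.existsUnique_path · r)
  have hr : f r = .nil := (hf' r .nil .nil).symm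
  refine ⟨fun v => (f v).snd, fun v => (f v).length, by simp [hr], fun v hv => ?_, fun v hv => ?_,
    fun v w hvw => ?_⟩
  · exact (f v).adj_snd (SimpleGraph.Walk.not_nil_of_ne hv)
  · rw [← hf' _ _ (hf v).tail]
    exact (SimpleGraph.Walk.length_tail_add_one (SimpleGraph.Walk.not_nil_of_ne hv)).symm
  · by_cases hw : w ∈ (f v).support
    · refine .inl ⟨?_, (hT.isAcyclic.eq_snd_of_adj_start (hf v) hvw hw).symm⟩
      rintro rfl
      rw [hr] at hw
      simp only [SimpleGraph.Walk.support_nil, List.mem_singleton] at hw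
      exact hvw.ne hw.symm
    · have hc := hf' w (.cons hvw.symm (f v)) ((hf v).cons hw)
      refine .inr ⟨?_, ?_⟩
      · rintro rfl
        exact hw (f v).end_mem_support
      · simp [← hc]

namespace IsRooting

variable {V : Type*} {T : SimpleGraph V} {r : V} {p : V → V} {δ : V → ℕ}

theorem edge_injective (h : IsRooting T r p δ) {v w : V} (hv : v ≠ r) (hw : w ≠ r)
    (he : s(v, p v) = s(w, p w)) : v = w := by
  rcases Sym2.eq_iff.1 he with ⟨h1, -⟩ | ⟨h1, h2⟩
  · exact h1
  · have h3 := h.depth v hv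
    have h4 := h.depth w hw
    rw [h2] at h3
    rw [← h1] at h4
    omega

theorem exists_edge_eq (h : IsRooting T r p δ) {e : Sym2 V} (he : e ∈ T.edgeSet) :
    ∃ v, v ≠ r ∧ e = s(v, p v) := by
  induction e using Sym2.ind with
  | _ a b =>
    rcases h.cover a b he with ⟨h1, h2⟩ | ⟨h1, h2⟩
    · exact ⟨a, h1, by rw [h2]⟩
    · exact ⟨b, h1, by rw [h2, Sym2.eq_swap]⟩

theorem edge_mem (h : IsRooting T r p δ) {v : V} (hv : v ≠ r) : s(v, p v) ∈ T.edgeSet :=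
  h.adj v hv

theorem child_unique [Fintype V] [DecidableRel T.Adj] (h : IsRooting T r p δ) {v a b : V}
    (hv : v ≠ r) (hd : T.degree v ≤ 2)
    (ha : a ≠ r) (hb : b ≠ r) (hpa : p a = v) (hpb : p b = v) : a = b := by
  classical
  by_contra hab
  have h1 := h.depth v hv
  have h2 := h.depth a ha
  have h3 := h.depth b hb
  rw [hpa] at h2
  rw [hpb] at h3
  have hsub : ({p v, a, b} : Finset V) ⊆ T.neighborFinset v := by
    intro x hx
    simp only [Finset.mem_insert, Finset.mem_singleton] at hx
    rw [SimpleGraph.mem_neighborFinset]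
    rcases hx with rfl | rfl | rfl
    · exact h.adj v hv
    · exact hpa ▸ (h.adj _ ha).symm
    · exact hpb ▸ (h.adj _ hb).symm
  have hpa' : p v ≠ a := by rintro h4; rw [h4] at h1; omega
  have hpb' : p v ≠ b := by rintro h4; rw [h4] at h1; omega
  have hc := Finset.card_le_card hsub
  rw [Finset.card_eq_three.2 ⟨_, _, _, hpa', hpb', hab, rfl⟩,
    SimpleGraph.card_neighborFinset_eq_degree] at hc
  omega

end IsRooting

/-- A finite tree without vertices of degree at least three is a path. -/
theorem isPathGraph_of_degree_le_two {V : Type*} [Fintype V] [DecidableEq V] {T : SimpleGraph V}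
    [DecidableRel T.Adj] (hT : T.IsTree) (hd : ∀ v, T.degree v ≤ 2) : IsPathGraph T := by
  obtain ⟨r, hr⟩ : ∃ r, T.degree r ≤ 1 := by
    rcases subsingleton_or_nontrivial V with hV | hV
    · obtain ⟨r⟩ := hT.connected.nonempty
      have := T.degree_lt_card_verts r
      have := Fintype.card_le_one_iff_subsingleton.2 hV
      exact ⟨r, by omega⟩
    · obtain ⟨r, hr⟩ := hT.exists_vert_degree_one_of_nontrivial
      exact ⟨r, hr.le⟩
  obtain ⟨p, δ, h⟩ := exists_isRooting hT r
  have hchild : ∀ a b, a ≠ r → b ≠ r → p a = p b → a = b := by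
    intro a b ha hb hab
    by_cases hv : p a = r
    · rw [← SimpleGraph.card_neighborFinset_eq_degree, Finset.card_le_one] at hr
      refine hr a ?_ b ?_
      · rw [SimpleGraph.mem_neighborFinset]; exact hv ▸ (h.adj a ha).symm
      · rw [SimpleGraph.mem_neighborFinset]; exact hv ▸ hab ▸ (h.adj b hb).symm
    · exact h.child_unique hv (hd _) ha hb rfl hab.symm
  have hzero : ∀ v, δ v = 0 → v = r := by
    intro v hv
    by_contra hne
    have := h.depth v hne
    omega
  have hinj : ∀ n a b, δ a = n → δ b = n → a = b := by
    intro n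
    induction n with
    | zero => intro a b ha hb; rw [hzero a ha, hzero b hb]
    | succ n ih =>
      intro a b ha hb
      have har : a ≠ r := by rintro rfl; have := h.depth_root; omega
      have hbr : b ≠ r := by rintro rfl; have := h.depth_root; omega
      have h1 := h.depth a har
      have h2 := h.depth b hbr
      exact hchild a b har hbr (ih _ _ (by omega) (by omega))
  have hdown : ∀ n v, δ v = n → ∀ m ≤ n, ∃ w, δ w = m := by
    intro n
    induction n with
    | zero => intro v hv m hm; exact ⟨v, by omega⟩
    | succ n ih =>
      intro v hv m hm
      have hvr : v ≠ r := by rintro rfl; have := h.depth_root; omega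
      have h1 := h.depth v hvr
      rcases Nat.lt_or_ge n m with hlt | hge
      · exact ⟨v, by omega⟩
      · exact ih (p v) (by omega) m hge
  have hlt : ∀ v, δ v < Fintype.card V := by
    intro v
    have hsub : Finset.range (δ v + 1) ⊆ Finset.univ.image δ := by
      intro m hm
      obtain ⟨w, hw⟩ := hdown _ v rfl m (by simpa [Nat.lt_succ_iff] using hm)
      exact Finset.mem_image.2 ⟨w, Finset.mem_univ _, hw⟩
    have h1 := Finset.card_le_card hsub
    have h2 := Finset.card_image_le (s := (Finset.univ : Finset V)) (f := δ)
    rw [Finset.card_range] at h1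
    rw [Finset.card_univ] at h2
    omega
  let f : V → Fin (Fintype.card V) := fun v => ⟨δ v, hlt v⟩
  have hf : Function.Bijective f := by
    rw [Fintype.bijective_iff_injective_and_card]
    exact ⟨fun a b hab => hinj _ a b rfl (Fin.mk.inj hab).symm, by simp⟩
  have hsucc : ∀ a b, δ a + 1 = δ b → T.Adj a b := by
    intro a b hab
    have hbr : b ≠ r := by rintro rfl; have := h.depth_root; omega
    have h1 := h.depth b hbr
    rw [hinj _ a (p b) rfl (by omega)]
    exact (h.adj b hbr).symm
  refine ⟨Equiv.ofBijective f hf, fun {a b} => ?_⟩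
  rw [SimpleGraph.pathGraph_adj]
  constructor
  · rintro (h1 | h1)
    · exact hsucc a b h1
    · exact (hsucc b a h1).symm
  · intro hab
    rcases h.cover a b hab with ⟨h1, rfl⟩ | ⟨h1, rfl⟩
    · exact .inr (h.depth a h1).symm
    · exact .inl (h.depth b h1).symm

/-- A path that meets an inner vertex `x` in the edge `xy` has another edge at `x`. -/
theorem exists_ne_mem_edges_of_isPath {V : Type*} {G : SimpleGraph V} {u v x y : V}
    (w : G.Walk u v) (hw : w.IsPath) (hxu : x ≠ u) (hxv : x ≠ v) (hxy : s(x, y) ∈ w.edges) :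
    ∃ z, z ≠ y ∧ s(x, z) ∈ w.edges := by
  induction w with
  | nil => simp at hxy
  | @cons a b c hab q ih =>
    rw [SimpleGraph.Walk.cons_isPath_iff] at hw
    rw [SimpleGraph.Walk.edges_cons, List.mem_cons] at hxy
    simp only [SimpleGraph.Walk.edges_cons, List.mem_cons]
    rcases hxy with hxy | hxy
    · rcases Sym2.eq_iff.1 hxy with ⟨h1, -⟩ | ⟨rfl, rfl⟩
      · exact absurd h1 hxu
      · have hmem := SimpleGraph.Walk.mk_start_snd_mem_edges (p := q)
          (SimpleGraph.Walk.not_nil_of_ne hxv)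
        refine ⟨q.snd, ?_, .inr hmem⟩
        intro h
        exact hw.2 (h ▸ q.snd_mem_support_of_mem_edges hmem)
    · by_cases hxb : x = b
      · subst hxb
        refine ⟨a, ?_, .inl Sym2.eq_swap⟩
        rintro rfl
        exact hw.2 (q.snd_mem_support_of_mem_edges hxy)
      · obtain ⟨z, hz, hz'⟩ := ih hw.1 hxb hxv hxy
        exact ⟨z, hz, .inr hz'⟩

/-- In a rooted tree with at least three vertices, a family of paths separating the edges has at
least as many members as there are vertices of degree at most two other than the root. -/
theorem IsRooting.card_le_of_separating {V : Type*} [Fintype V] [DecidableEq V]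
    {T : SimpleGraph V} [DecidableRel T.Adj] {r : V} {p : V → V} {δ : V → ℕ}
    (h : IsRooting T r p δ) (hV : 3 ≤ Fintype.card V) {m : ℕ} (P : Fin m → GraphPath T)
    (hP : ∀ e ∈ T.edgeSet, ∀ f ∈ T.edgeSet, e ≠ f → ∃ i, (P i).HasEdge e ∧ ¬ (P i).HasEdge f) :
    (Finset.univ.filter fun v => v ≠ r ∧ T.degree v ≤ 2).card ≤ m := by
  classical
  let d : V → Finset (Fin m) := fun v => Finset.univ.filter fun i => (P i).1 = v ∨ (P i).2.1 = v
  let X : V → Finset (Fin m) := fun v => Finset.univ.filter fun i => (P i).HasEdge s(v, p v)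
  let s : V → ℕ := fun v => if (X v).card = 1 then 1 else 0
  let Ch : V → Finset V := fun v => Finset.univ.filter fun c => c ≠ r ∧ p c = v
  have hX : ∀ v i, i ∈ X v ↔ (P i).HasEdge s(v, p v) := fun v i => by simp [X]
  have hadj : ∀ i v w, (P i).HasEdge s(v, w) → T.Adj v w :=
    fun i v w hvw => (P i).2.2.1.adj_of_mem_edges hvw
  have hend : ∀ i v w, (P i).HasEdge s(v, w) → (∀ z, z ≠ w → ¬ (P i).HasEdge s(v, z)) →
      i ∈ d v := by
    intro i v w hvw hz
    simp only [d, Finset.mem_filter, Finset.mem_univ, true_and]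
    by_contra hcon
    push Not at hcon
    obtain ⟨z, hz1, hz2⟩ :=
      exists_ne_mem_edges_of_isPath _ (P i).2.2.2 (Ne.symm hcon.1) (Ne.symm hcon.2) hvw
    exact hz z hz1 hz2
  have hlight : ∀ v, v ≠ r → (X v).card = 1 → ∀ i ∈ X v, ∀ f, (P i).HasEdge f →
      f = s(v, p v) := by
    intro v hv hc i hi f hf
    by_contra hne
    have hfE : f ∈ T.edgeSet := (P i).2.2.1.edges_subset_edgeSet hf
    obtain ⟨j, hj1, hj2⟩ := hP _ (h.edge_mem hv) f hfE (Ne.symm hne)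
    have : j = i := Finset.card_le_one.1 hc.le j ((hX v j).2 hj1) i hi
    exact hj2 (this ▸ hf)
  have hlight_end : ∀ v, v ≠ r → (X v).card = 1 → ∀ i ∈ X v, i ∈ d (p v) := by
    intro v hv hc i hi
    refine hend i (p v) v (by rw [Sym2.eq_swap]; exact (hX v i).1 hi) fun z hz hz' => ?_
    have h1 := hlight v hv hc i hi _ hz'
    rw [Sym2.eq_swap] at h1
    exact hz ((Sym2.congr_left).1 h1)
  have hXpos : ∀ v, v ≠ r → 2 ≤ (X v).card + s v := by
    intro v hv
    obtain ⟨w, hw⟩ : ∃ w, w ∉ ({r, v} : Finset V) := by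
      by_contra hcon
      push Not at hcon
      have h1 := Finset.card_le_card (fun x _ => hcon x : Finset.univ ⊆ ({r, v} : Finset V))
      have h2 := Finset.card_le_two (a := r) (b := v)
      rw [Finset.card_univ] at h1
      omega
    simp only [Finset.mem_insert, Finset.mem_singleton, not_or] at hw
    obtain ⟨i, hi, -⟩ := hP _ (h.edge_mem hv) _ (h.edge_mem hw.1)
      fun he => hw.2 (h.edge_injective hv hw.1 he).symm
    have : 0 < (X v).card := Finset.card_pos.2 ⟨i, (hX v i).2 hi⟩
    simp only [s]
    split_ifs <;> omega
  have hall : ∀ v, ∑ c ∈ Ch v, s c ≤ (d v).card := by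
    intro v
    rw [Finset.sum_boole, Nat.cast_id]
    have hex : ∀ c ∈ (Ch v).filter (fun c => (X c).card = 1), ∃ i, i ∈ X c := by
      intro c hc
      exact Finset.card_pos.1 (by have := (Finset.mem_filter.1 hc).2; omega)
    rcases ((Ch v).filter fun c => (X c).card = 1).eq_empty_or_nonempty with hemp | ⟨c₀, hc₀⟩
    · simp [hemp]
    have : Nonempty (Fin m) := ⟨(hex c₀ hc₀).choose⟩
    choose! g hg using hex
    refine Finset.card_le_card_of_injOn g ?_ ?_
    · intro c hc
      have hc1 := hg c hc
      obtain ⟨hc2, hc3⟩ := Finset.mem_filter.1 hc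
      simp only [Ch, Finset.mem_filter, Finset.mem_univ, true_and] at hc2
      exact hc2.2 ▸ hlight_end c hc2.1 hc3 _ hc1
    · intro a ha b hb hab
      have ha1 := hg a ha
      have hb1 := hg b hb
      obtain ⟨ha2, ha3⟩ := Finset.mem_filter.1 ha
      obtain ⟨hb2, hb3⟩ := Finset.mem_filter.1 hb
      simp only [Ch, Finset.mem_filter, Finset.mem_univ, true_and] at ha2 hb2
      refine (h.edge_injective hb2.1 ha2.1 (hlight a ha2.1 ha3 _ ha1 _ ?_)).symm
      rw [hab]
      exact (hX _ _).1 hb1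
  have hlow : ∀ v, v ≠ r → T.degree v ≤ 2 → 2 + ∑ c ∈ Ch v, s c ≤ (d v).card + s v := by
    intro v hv hdeg
    have hXv := hXpos v hv
    rcases (Ch v).eq_empty_or_nonempty with hCh | ⟨c, hc⟩
    · have hsub : X v ⊆ d v := by
        intro i hi
        refine hend i v (p v) ((hX v i).1 hi) fun z hz hz' => ?_
        rcases h.cover v z (hadj i v z hz') with ⟨-, h1⟩ | ⟨h1, h2⟩
        · exact hz h1.symm
        · have : z ∈ Ch v := by simp [Ch, h1, h2]
          simp [hCh] at this
      have := Finset.card_le_card hsub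
      rw [hCh, Finset.sum_empty]
      omega
    · have hc' : c ≠ r ∧ p c = v := by simpa [Ch] using hc
      have huniq : ∀ z, z ≠ r → p z = v → z = c :=
        fun z h1 h2 => h.child_unique hv hdeg h1 hc'.1 h2 hc'.2
      have hCh : Ch v = {c} := by
        ext z
        simp only [Finset.mem_singleton]
        constructor
        · intro hz
          have : z ≠ r ∧ p z = v := by simpa [Ch] using hz
          exact huniq z this.1 this.2
        · rintro rfl; exact hc
      have hcv : s(v, c) = s(c, p c) := by rw [hc'.2, Sym2.eq_swap]
      have hne : s(v, p v) ≠ s(c, p c) := by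
        intro he
        have h1 := h.edge_injective hv hc'.1 he
        have h2 := h.depth c hc'.1
        rw [hc'.2, h1] at h2
        omega
      have hup : ∀ i, i ∈ X v → i ∉ X c → i ∈ d v := by
        intro i hi hic
        refine hend i v (p v) ((hX v i).1 hi) fun z hz hz' => ?_
        rcases h.cover v z (hadj i v z hz') with ⟨-, h1⟩ | ⟨h1, h2⟩
        · exact hz h1.symm
        · rw [huniq z h1 h2, hcv] at hz'
          exact hic ((hX c i).2 hz')
      have hdown : ∀ i, i ∈ X c → i ∉ X v → i ∈ d v := by
        intro i hi hiv
        refine hend i v c (hcv ▸ (hX c i).1 hi) fun z hz hz' => ?_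
        rcases h.cover v z (hadj i v z hz') with ⟨-, h1⟩ | ⟨h1, h2⟩
        · exact hiv ((hX v i).2 (h1 ▸ hz'))
        · exact hz (huniq z h1 h2)
      rw [hCh, Finset.sum_singleton]
      by_cases hlc : (X c).card = 1
      · have hdisj : Disjoint (X v) (X c) := by
          rw [Finset.disjoint_left]
          intro i hi1 hi2
          exact hne (hlight c hc'.1 hlc i hi2 _ ((hX v i).1 hi1))
        have hsub : X v ∪ X c ⊆ d v := by
          intro i hi
          rcases Finset.mem_union.1 hi with hi | hi
          · exact hup i hi (Finset.disjoint_left.1 hdisj hi)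
          · exact hdown i hi (Finset.disjoint_right.1 hdisj hi)
        have h1 := Finset.card_le_card hsub
        rw [Finset.card_union_of_disjoint hdisj] at h1
        have h2 : s c = 1 := if_pos hlc
        omega
      · obtain ⟨i, hi1, hi2⟩ := hP _ (h.edge_mem hv) _ (h.edge_mem hc'.1) hne
        obtain ⟨j, hj1, hj2⟩ := hP _ (h.edge_mem hc'.1) _ (h.edge_mem hv) hne.symm
        have hij : i ≠ j := by rintro rfl; exact hi2 hj1
        have hsub : {i, j} ⊆ d v := by
          intro x hx
          simp only [Finset.mem_insert, Finset.mem_singleton] at hx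
          rcases hx with rfl | rfl
          · exact hup _ ((hX _ _).2 hi1) (fun h => hi2 ((hX _ _).1 h))
          · exact hdown _ ((hX _ _).2 hj1) (fun h => hj2 ((hX _ _).1 h))
        have h1 := Finset.card_le_card hsub
        rw [Finset.card_pair hij] at h1
        have h2 : s c = 0 := if_neg hlc
        omega
  have hsum_d : ∑ v, (d v).card ≤ 2 * m := by
    have h1 : ∑ v, (d v).card = ∑ i : Fin m,
        (Finset.univ.filter fun v => (P i).1 = v ∨ (P i).2.1 = v).card :=
      Finset.sum_card_bipartiteAbove_eq_sum_card_bipartiteBelow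
        (s := Finset.univ) (t := Finset.univ) fun v i => (P i).1 = v ∨ (P i).2.1 = v
    rw [h1]
    refine (Finset.sum_le_card_nsmul _ _ 2 fun i _ => ?_).trans (by simp [mul_comm])
    refine (Finset.card_le_card (t := {(P i).1, (P i).2.1}) fun v hv => ?_).trans
      Finset.card_le_two
    simpa [eq_comm] using hv
  have hsum_s : ∑ v, ∑ c ∈ Ch v, s c = ∑ c ∈ Finset.univ.filter (· ≠ r), s c := by
    rw [← Finset.sum_fiberwise (Finset.univ.filter (· ≠ r)) p s]
    refine Finset.sum_congr rfl fun v _ => Finset.sum_congr ?_ fun _ _ => rfl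
    ext c
    simp [Ch]
  have htotal : ∑ v, ((if v ≠ r ∧ T.degree v ≤ 2 then 2 else 0) + ∑ c ∈ Ch v, s c) ≤
      ∑ v, ((d v).card + if v ≠ r then s v else 0) := by
    refine Finset.sum_le_sum fun v _ => ?_
    have h1 := hall v
    by_cases hv : v ≠ r
    · by_cases hdeg : T.degree v ≤ 2
      · rw [if_pos ⟨hv, hdeg⟩, if_pos hv]
        exact hlow v hv hdeg
      · rw [if_neg fun h => hdeg h.2]
        omega
    · rw [if_neg fun h => hv h.1]
      omega
  have hs : ∑ v, (if v ≠ r then s v else 0) = ∑ c ∈ Finset.univ.filter (· ≠ r), s c :=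
    (Finset.sum_filter _ _).symm
  have htwo : ∑ v, (if v ≠ r ∧ T.degree v ≤ 2 then 2 else 0) =
      (Finset.univ.filter fun v => v ≠ r ∧ T.degree v ≤ 2).card * 2 := by
    rw [← Finset.sum_filter, Finset.sum_const, smul_eq_mul]
  rw [Finset.sum_add_distrib, Finset.sum_add_distrib, hsum_s, hs, htwo] at htotal
  omega

/-- A rainbow separating path system of a tree on `n` vertices with `B` vertices of degree at least
three has at least `n - B - 2` members. -/
theorem card_le_rainbowSepNumber_add {V : Type*} [Fintype V] {T : SimpleGraph V}
    (hT : T.IsTree) {k : ℕ} (hk : 2 ≤ k) :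
    Fintype.card V ≤ rainbowSepNumber T k + numBranchVertices T + 2 := by
  classical
  rcases Nat.lt_or_ge (Fintype.card V) 3 with hV | hV
  · omega
  obtain ⟨P, ⟨Q, rfl, hQ⟩, hcard⟩ := exists_isRSPS_card_eq T hk
  obtain ⟨r⟩ := hT.connected.nonempty
  obtain ⟨p, δ, h⟩ := exists_isRooting hT r
  let L := (Q.map Prod.fst).toList
  have hL : L.length = rainbowSepNumber T k := by rw [← hcard]; simp [L]
  have h1 := h.card_le_of_separating hV L.get (by
    intro e he f hf hef
    obtain ⟨x, hx, -, -, -, hx1, -⟩ := hQ e he f hf hef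
    have : x.1 ∈ L := by
      simp only [L, Multiset.mem_toList]
      exact Multiset.mem_map_of_mem _ hx
    obtain ⟨i, hi⟩ := List.mem_iff_get.1 this
    exact ⟨i, hi ▸ hx1⟩)
  have h2 : numBranchVertices T = (Finset.univ.filter fun v : V => 3 ≤ T.degree v).card := by
    unfold numBranchVertices
    congr!
  have h3 : (Finset.univ : Finset V) ⊆ (Finset.univ.filter fun v => v ≠ r ∧ T.degree v ≤ 2) ∪
      (Finset.univ.filter fun v : V => 3 ≤ T.degree v) ∪ {r} := by
    intro v _
    by_cases hv : v = r
    · simp [hv]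
    · simp only [Finset.mem_union, Finset.mem_filter, Finset.mem_univ, true_and]
      by_cases hd : 3 ≤ T.degree v
      · exact .inl (.inr hd)
      · exact .inl (.inl ⟨hv, by omega⟩)
  have h4 := Finset.card_le_card h3
  have h5 := Finset.card_union_le ((Finset.univ.filter fun v => v ≠ r ∧ T.degree v ≤ 2) ∪
      (Finset.univ.filter fun v : V => 3 ≤ T.degree v)) {r}
  have h6 := Finset.card_union_le (Finset.univ.filter fun v => v ≠ r ∧ T.degree v ≤ 2)
      (Finset.univ.filter fun v : V => 3 ≤ T.degree v)
  rw [Finset.card_univ] at h4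
  rw [Finset.card_singleton] at h5
  omega

/-- Greedy colouring with four colours along a well-founded measure `μ`, extending a prescribed
colouring `κ₀` of the vertices in `C`. -/
theorem exists_greedy_coloring {α β : Type*} [DecidableEq α] [LT β] [WellFoundedLT β] (μ : α → β)
    (C : α → Prop) (κ₀ : α → Fin 4) (B : α → Finset α) (hcard : ∀ v, ¬ C v → (B v).card ≤ 3)
    (hlt : ∀ v, ¬ C v → ∀ w ∈ B v, μ w < μ v) :
    ∃ κ : α → Fin 4, (∀ v, C v → κ v = κ₀ v) ∧ ∀ v, ¬ C v → ∀ w ∈ B v, κ v ≠ κ w := by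
  classical
  have hpick : ∀ s : Finset (Fin 4), ∃ c, s.card ≤ 3 → c ∉ s := by
    intro s
    by_cases hs : s = Finset.univ
    · exact ⟨0, fun h => by simp [hs] at h⟩
    · obtain ⟨c, hc⟩ : ∃ c, c ∉ s := by
        by_contra hcon
        push Not at hcon
        exact hs (Finset.eq_univ_iff_forall.2 hcon)
      exact ⟨c, fun _ => hc⟩
  choose pick hpick using hpick
  have wf : WellFounded (InvImage (· < ·) μ) := InvImage.wf μ wellFounded_lt
  let F : (v : α) → ((w : α) → InvImage (· < ·) μ w v → Fin 4) → Fin 4 := fun v rec =>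
    if C v then κ₀ v else pick ((B v).image fun w => if h : μ w < μ v then rec w h else 0)
  refine ⟨wf.fix F, fun v hv => ?_, fun v hv w hw heq => ?_⟩
  · rw [wf.fix_eq]
    exact if_pos hv
  · rw [wf.fix_eq F v] at heq
    simp only [F, if_neg hv] at heq
    refine hpick ((B v).image fun w => if h : μ w < μ v then wf.fix F w else 0)
      (Finset.card_image_le.trans (hcard v hv)) ?_
    rw [Finset.mem_image]
    refine ⟨w, hw, ?_⟩
    rw [dif_pos (hlt v hv w hw)]
    exact heq.symm

/-- A system of successive edges in a rooted tree: every nonroot vertex `v` has a predecessor `φ v`,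
which is its parent or one of its siblings, and no vertex precedes two of its children, or two of
its siblings. The children of the root are arranged in a cycle of length `D`. -/
structure IsPredecessor {V : Type*} (r : V) (p : V → V) (δ : V → ℕ) (D : ℕ) (φ : V → V)
    (ρ : V → ℕ) : Prop where
  ne_root : ∀ v, v ≠ r → φ v ≠ r
  parent_or_sibling : ∀ v, v ≠ r → p v = φ v ∨ (p v = p (φ v) ∧ v ≠ φ v)
  inj : ∀ v w, v ≠ r → w ≠ r → φ v = φ w → p v = p w → v = w
  lt : ∀ v, v ≠ r → p v ≠ r → toLex (δ (φ v), ρ (φ v)) < toLex (δ v, ρ v)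
  root : ∀ v, v ≠ r → p v = r → p (φ v) = r ∧ ρ v < D ∧
    (ρ v = ρ (φ v) + 1 ∨ (ρ v = 0 ∧ ρ (φ v) + 1 = D))
  root_inj : ∀ v w, v ≠ r → w ≠ r → p v = r → p w = r → ρ v = ρ w → v = w

theorem IsRooting.exists_isPredecessor {V : Type*} [Fintype V] [DecidableEq V]
    {T : SimpleGraph V} [DecidableRel T.Adj] {r : V} {p : V → V} {δ : V → ℕ}
    (h : IsRooting T r p δ) (hr : 3 ≤ T.degree r) :
    ∃ D φ ρ, 3 ≤ D ∧ IsPredecessor r p δ D φ ρ := by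
  let Ch : V → Finset V := fun q => Finset.univ.filter fun c => c ≠ r ∧ p c = q
  have hCh : ∀ q c, c ∈ Ch q ↔ c ≠ r ∧ p c = q := fun q c => by simp [Ch]
  have hexρ : ∀ q, ∃ ρ : V → ℕ, Set.BijOn ρ (Ch q) (Set.Iio (Ch q).card) := by
    intro q
    let e := (Ch q).equivFin
    refine ⟨fun v => if hv : v ∈ Ch q then e ⟨v, hv⟩ else 0, fun v hv => ?_, fun v hv w hw hvw => ?_,
      fun j hj => ?_⟩
    · have hv' : v ∈ Ch q := hv
      simp [hv']
    · have hv' : v ∈ Ch q := hv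
      have hw' : w ∈ Ch q := hw
      simp only [hv', hw', dif_pos] at hvw
      exact congrArg Subtype.val (e.injective (Fin.ext hvw))
    · refine ⟨e.symm ⟨j, hj⟩, (e.symm ⟨j, hj⟩).2, ?_⟩
      simp
  choose ρ' hρ' using hexρ
  let ρ : V → ℕ := fun v => ρ' (p v) v
  have hinj : ∀ v w, v ≠ r → w ≠ r → p v = p w → ρ v = ρ w → v = w := by
    intro v w hv hw hp hρ
    refine (hρ' (p v)).injOn ((hCh _ _).2 ⟨hv, rfl⟩) ((hCh _ _).2 ⟨hw, hp.symm⟩) ?_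
    simpa only [ρ, ← hp] using hρ
  have hlt : ∀ v, v ≠ r → ρ v < (Ch (p v)).card :=
    fun v hv => (hρ' (p v)).mapsTo ((hCh _ _).2 ⟨hv, rfl⟩)
  have hsurj : ∀ q j, j < (Ch q).card → ∃ w, w ≠ r ∧ p w = q ∧ ρ w = j := by
    intro q j hj
    obtain ⟨w, hw, rfl⟩ := (hρ' q).surjOn hj
    obtain ⟨h1, rfl⟩ := (hCh q w).1 hw
    exact ⟨w, h1, rfl, rfl⟩
  have hD : (Ch r).card = T.degree r := by
    rw [← SimpleGraph.card_neighborFinset_eq_degree]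
    congr 1
    ext c
    rw [hCh, SimpleGraph.mem_neighborFinset]
    constructor
    · rintro ⟨h1, h2⟩
      exact h2 ▸ (h.adj c h1).symm
    · intro hc
      rcases h.cover r c hc with ⟨h1, -⟩ | h1
      · exact absurd rfl h1
      · exact h1
  have hexφ : ∀ v, ∃ u, v ≠ r → u ≠ r ∧ ((u = p v ∧ p v ≠ r ∧ ρ v = 0) ∨
      (p u = p v ∧ ρ v = ρ u + 1) ∨
      (p u = r ∧ p v = r ∧ ρ v = 0 ∧ ρ u + 1 = (Ch r).card)) := by
    intro v
    by_cases hv : v = r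
    · exact ⟨v, fun h => absurd hv h⟩
    by_cases h0 : ρ v = 0
    · by_cases hp : p v = r
      · obtain ⟨w, hw1, hw2, hw3⟩ := hsurj r ((Ch r).card - 1) (by omega)
        exact ⟨w, fun _ => ⟨hw1, .inr (.inr ⟨hw2, hp, h0, by omega⟩)⟩⟩
      · exact ⟨p v, fun _ => ⟨hp, .inl ⟨rfl, hp, h0⟩⟩⟩
    · obtain ⟨w, hw1, hw2, hw3⟩ := hsurj (p v) (ρ v - 1) (by have := hlt v hv; omega)
      exact ⟨w, fun _ => ⟨hw1, .inr (.inl ⟨hw2, by omega⟩)⟩⟩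
  choose φ hφ using hexφ
  have hne : ∀ v, v ≠ r → p v ≠ v := fun v hv hpv => by
    have := h.depth v hv
    rw [hpv] at this
    omega
  refine ⟨(Ch r).card, φ, ρ, by omega, fun v hv => (hφ v hv).1, fun v hv => ?_,
    fun v w hv hw h1 h2 => ?_, fun v hv hp => ?_, fun v hv hp => ?_,
    fun v w hv hw h1 h2 => hinj v w hv hw (h1.trans h2.symm)⟩
  · obtain ⟨h1, h2 | h2 | h2⟩ := hφ v hv
    · exact .inl h2.1.symm
    · refine .inr ⟨h2.1.symm, fun h3 => ?_⟩
      have := congrArg ρ h3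
      omega
    · refine .inr ⟨h2.2.1.trans h2.1.symm, fun h3 => ?_⟩
      have := congrArg ρ h3
      omega
  · refine hinj v w hv hw h2 ?_
    obtain ⟨h3, h4⟩ := hφ v hv
    obtain ⟨-, h5⟩ := hφ w hw
    have h6 := hne _ h3
    have h7 := congrArg ρ h1
    have h8 := congrArg p h1
    rcases h4 with h4 | h4 | h4 <;> rcases h5 with h5 | h5 | h5
    · omega
    · exact absurd (by rw [h8, h5.1, ← h2, h4.1]) h6
    · exact absurd (h2.trans h5.2.1) h4.2.1
    · exact absurd (by rw [h4.1, h2, ← h5.1, h1]) h6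
    · omega
    · have h9 := hlt v hv
      rw [h2, h5.2.1] at h9
      omega
    · exact absurd (h2.symm.trans h4.2.1) h5.2.1
    · have h9 := hlt w hw
      rw [← h2, h4.2.1] at h9
      omega
    · omega
  · obtain ⟨h1, h2 | h2 | h2⟩ := hφ v hv
    · have := h.depth v hv
      rw [← h2.1] at this
      exact Prod.Lex.toLex_lt_toLex.2 (.inl (by simp only; omega))
    · have h3 := h.depth v hv
      have h4 := h.depth _ h1
      rw [h2.1] at h4
      exact Prod.Lex.toLex_lt_toLex.2 (.inr ⟨by simp only; omega, by simp only; omega⟩)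
    · exact absurd h2.2.1 hp
  · have h3 := hlt v hv
    rw [hp] at h3
    obtain ⟨h1, h2 | h2 | h2⟩ := hφ v hv
    · exact absurd hp h2.2.1
    · exact ⟨h2.1.trans hp, h3, .inl h2.2⟩
    · exact ⟨h2.1, h3, .inr h2.2.2⟩

/-- The edge above `u` forms a path with the edges above the vertices preceded by `u`. -/
theorem IsPredecessor.exists_path {V : Type*} {T : SimpleGraph V} {r : V} {p : V → V} {δ : V → ℕ}
    {D : ℕ} {φ : V → V} {ρ : V → ℕ} (hφ : IsPredecessor r p δ D φ ρ) (h : IsRooting T r p δ)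
    {u : V} (hu : u ≠ r) :
    ∃ Q : GraphPath T, ∀ v, v ≠ r → (Q.HasEdge s(v, p v) ↔ v = u ∨ φ v = u) := by
  have hinj : ∀ v w, v ≠ r → w ≠ r → (s(v, p v) = s(w, p w) ↔ v = w) :=
    fun v w hv hw => ⟨h.edge_injective hv hw, by rintro rfl; rfl⟩
  have hmem : ∀ v, v ≠ r → φ v = u → p v = u ∨ p v = p u := by
    intro v hv hvu
    rcases hφ.parent_or_sibling v hv with h1 | h1
    · exact .inl (h1.trans hvu)
    · exact .inr (hvu ▸ h1.1)
  have hup : u ≠ p u := (h.adj u hu).ne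
  have hdu := h.depth u hu
  have hbu : ∀ b, b ≠ r → φ b = u → p b = p u → b ≠ u := by
    rintro b hb hb1 hb2 rfl
    rcases hφ.parent_or_sibling b hb with h1 | h1
    · exact hup (hb1.symm.trans h1.symm)
    · exact h1.2 hb1.symm
  have hsib : ∀ b, b ≠ r → p b = p u → T.Adj (p u) b := fun b hb hb' => hb' ▸ (h.adj b hb).symm
  have hchild : ∀ a, a ≠ r → p a = u → T.Adj a u ∧ a ≠ p u := by
    intro a ha hau
    have h1 := h.depth a ha
    rw [hau] at h1
    exact ⟨hau ▸ h.adj a ha, by rintro rfl; omega⟩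
  by_cases hA : ∃ a, a ≠ r ∧ φ a = u ∧ p a = u <;> by_cases hB : ∃ b, b ≠ r ∧ φ b = u ∧ p b = p u
  · obtain ⟨a, ha, ha1, ha2⟩ := hA
    obtain ⟨b, hb, hb1, hb2⟩ := hB
    obtain ⟨hau, hap⟩ := hchild a ha ha2
    have hbpu := hsib b hb hb2
    have hab : a ≠ b := by rintro rfl; exact hup (ha2.symm.trans hb2)
    refine ⟨⟨a, b, .cons hau (.cons (h.adj u hu) (.cons hbpu .nil)), ?_⟩, fun v hv => ?_⟩
    · simp [SimpleGraph.Walk.isPath_def, hau.ne, hap, hab, hup, (hbu b hb hb1 hb2).symm, hbpu.ne]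
    · have e1 : s(a, u) = s(a, p a) := by rw [ha2]
      have e2 : s(p u, b) = s(b, p b) := by rw [hb2, Sym2.eq_swap]
      simp only [GraphPath.HasEdge, SimpleGraph.Walk.edges_cons, SimpleGraph.Walk.edges_nil,
        List.mem_cons, List.not_mem_nil, or_false, e1, e2, hinj _ _ hv ha, hinj _ _ hv hb,
        hinj _ _ hv hu]
      constructor
      · rintro (rfl | rfl | rfl)
        exacts [.inr ha1, .inl rfl, .inr hb1]
      · rintro (h1 | h1)
        · exact .inr (.inl h1)
        · rcases hmem v hv h1 with h2 | h2
          · exact .inl (hφ.inj _ _ hv ha (h1.trans ha1.symm) (h2.trans ha2.symm))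
          · exact .inr (.inr (hφ.inj _ _ hv hb (h1.trans hb1.symm) (h2.trans hb2.symm)))
  · obtain ⟨a, ha, ha1, ha2⟩ := hA
    obtain ⟨hau, hap⟩ := hchild a ha ha2
    refine ⟨⟨a, p u, .cons hau (.cons (h.adj u hu) .nil), ?_⟩, fun v hv => ?_⟩
    · simp [SimpleGraph.Walk.isPath_def, hau.ne, hap, hup]
    · have e1 : s(a, u) = s(a, p a) := by rw [ha2]
      simp only [GraphPath.HasEdge, SimpleGraph.Walk.edges_cons, SimpleGraph.Walk.edges_nil,
        List.mem_cons, List.not_mem_nil, or_false, e1, hinj _ _ hv ha, hinj _ _ hv hu]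
      constructor
      · rintro (rfl | rfl)
        exacts [.inr ha1, .inl rfl]
      · rintro (h1 | h1)
        · exact .inr h1
        · rcases hmem v hv h1 with h2 | h2
          · exact .inl (hφ.inj _ _ hv ha (h1.trans ha1.symm) (h2.trans ha2.symm))
          · exact absurd ⟨v, hv, h1, h2⟩ hB
  · obtain ⟨b, hb, hb1, hb2⟩ := hB
    have hbpu := hsib b hb hb2
    refine ⟨⟨u, b, .cons (h.adj u hu) (.cons hbpu .nil), ?_⟩, fun v hv => ?_⟩
    · simp [SimpleGraph.Walk.isPath_def, hup, (hbu b hb hb1 hb2).symm, hbpu.ne]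
    · have e2 : s(p u, b) = s(b, p b) := by rw [hb2, Sym2.eq_swap]
      simp only [GraphPath.HasEdge, SimpleGraph.Walk.edges_cons, SimpleGraph.Walk.edges_nil,
        List.mem_cons, List.not_mem_nil, or_false, e2, hinj _ _ hv hb, hinj _ _ hv hu]
      constructor
      · rintro (rfl | rfl)
        exacts [.inl rfl, .inr hb1]
      · rintro (h1 | h1)
        · exact .inl h1
        · rcases hmem v hv h1 with h2 | h2
          · exact absurd ⟨v, hv, h1, h2⟩ hA
          · exact .inr (hφ.inj _ _ hv hb (h1.trans hb1.symm) (h2.trans hb2.symm))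
  · refine ⟨⟨u, p u, .cons (h.adj u hu) .nil, ?_⟩, fun v hv => ?_⟩
    · simp [SimpleGraph.Walk.isPath_def, hup]
    · simp only [GraphPath.HasEdge, SimpleGraph.Walk.edges_cons, SimpleGraph.Walk.edges_nil,
        List.mem_cons, List.not_mem_nil, or_false, hinj _ _ hv hu]
      refine ⟨.inl, ?_⟩
      rintro (h1 | h1)
      · exact h1
      · rcases hmem v hv h1 with h2 | h2
        · exact absurd ⟨v, hv, h1, h2⟩ hA
        · exact absurd ⟨v, hv, h1, h2⟩ hB

/-- The colour of position `i` in a cycle of length `D`. -/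
def cycleColor (D i : ℕ) : ℕ := if i < D % 3 then 3 else (i - D % 3) % 3

theorem cycleColor_lt (D i : ℕ) : cycleColor D i < 4 := by
  unfold cycleColor
  split_ifs <;> omega

/-- `i` follows `j` in the cyclic order of `0, …, D - 1`. -/
def CycSucc (D i j : ℕ) : Prop := i < D ∧ (i = j + 1 ∨ (i = 0 ∧ j + 1 = D))

theorem cycleColor_ne {D i j l : ℕ} (hD : 3 ≤ D) (hij : CycSucc D i j) (hjl : CycSucc D j l) :
    cycleColor D i ≠ cycleColor D l := by
  obtain ⟨h1, h2⟩ := hij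
  obtain ⟨h3, h4⟩ := hjl
  unfold cycleColor
  split_ifs <;> omega

theorem eq_one_of_cycleColor_eq {D i j : ℕ} (hD : 3 ≤ D) (hij : CycSucc D i j)
    (hc : cycleColor D i = cycleColor D j) : i = 1 := by
  obtain ⟨h1, h2⟩ := hij
  unfold cycleColor at hc
  split_ifs at hc <;> omega

theorem IsPredecessor.exists_coloring {V : Type*} [Fintype V] {T : SimpleGraph V} {r : V}
    {p : V → V} {δ : V → ℕ} {D : ℕ} {φ : V → V} {ρ : V → ℕ} (hφ : IsPredecessor r p δ D φ ρ)
    (h : IsRooting T r p δ) (hD : 3 ≤ D) :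
    ∃ κ : V → Fin 4,
      (∀ v, v ≠ r → κ v ≠ κ (φ (φ v))) ∧
      (∀ v w, v ≠ r → w ≠ r → v ≠ w → φ v = φ w → κ v ≠ κ w) ∧
      (∀ v w, v ≠ r → w ≠ r → κ v = κ (φ v) → κ w = κ (φ w) → v = w) := by
  classical
  let B : V → Finset V := fun v =>
    {φ v, φ (φ v)} ∪ Finset.univ.filter fun w => w ≠ r ∧ φ w = φ v ∧ δ w < δ v
  have hBcard : ∀ v, ¬ (v = r ∨ p v = r) → (B v).card ≤ 3 := by
    intro v hv
    push Not at hv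
    refine (Finset.card_union_le _ _).trans ?_
    have h1 : ({φ v, φ (φ v)} : Finset V).card ≤ 2 := Finset.card_le_two
    have h2 : (Finset.univ.filter fun w => w ≠ r ∧ φ w = φ v ∧ δ w < δ v).card ≤ 1 := by
      rw [Finset.card_le_one]
      have key : ∀ w, w ≠ r → φ w = φ v → δ w < δ v → p w = p (φ v) := by
        intro w hw h1 h2
        rcases hφ.parent_or_sibling w hw with h3 | h3
        · exfalso
          have h4 := h.depth w hw
          rw [h3, h1] at h4
          have h5 := h.depth v hv.1
          rcases hφ.parent_or_sibling v hv.1 with h6 | h6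
          · rw [h6] at h5
            omega
          · have h7 := h.depth _ (hφ.ne_root v hv.1)
            rw [h6.1] at h5
            omega
        · rw [h3.1, h1]
      intro a ha b hb
      simp only [Finset.mem_filter, Finset.mem_univ, true_and] at ha hb
      exact hφ.inj a b ha.1 hb.1 (ha.2.1.trans hb.2.1.symm)
        ((key a ha.1 ha.2.1 ha.2.2).trans (key b hb.1 hb.2.1 hb.2.2).symm)
    omega
  have hδ : ∀ v, v ≠ r → p v = r → δ v = 1 := by
    intro v hv hp
    have := h.depth v hv
    rw [hp, h.depth_root] at this
    exact this
  have hBlt : ∀ v, ¬ (v = r ∨ p v = r) → ∀ w ∈ B v,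
      toLex (δ w, ρ w) < toLex (δ v, ρ v) := by
    intro v hv w hw
    push Not at hv
    have hlt := hφ.lt v hv.1 hv.2
    have hn := hφ.ne_root v hv.1
    simp only [B, Finset.mem_union, Finset.mem_insert, Finset.mem_singleton, Finset.mem_filter,
      Finset.mem_univ, true_and] at hw
    rcases hw with (rfl | rfl) | hw
    · exact hlt
    · by_cases hp : p (φ v) = r
      · have h1 := hδ _ (hφ.ne_root _ hn) (hφ.root _ hn hp).1
        have h2 := h.depth v hv.1
        have h3 := h.depth (p v) hv.2
        exact Prod.Lex.toLex_lt_toLex.2 (.inl (by simp only; omega))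
      · exact (hφ.lt _ hn hp).trans hlt
    · exact Prod.Lex.toLex_lt_toLex.2 (.inl hw.2.2)
  obtain ⟨κ, hκC, hκB⟩ := exists_greedy_coloring (fun v => toLex (δ v, ρ v))
    (fun v => v = r ∨ p v = r) (fun v => ⟨cycleColor D (ρ v), cycleColor_lt _ _⟩) B hBcard hBlt
  have hroot : ∀ v, v ≠ r → p v = r → p (φ v) = r ∧ CycSucc D (ρ v) (ρ (φ v)) := hφ.root
  have hmono : ∀ v, v ≠ r → κ v = κ (φ v) → p v = r ∧ ρ v = 1 := by
    intro v hv hc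
    by_cases hp : p v = r
    · obtain ⟨h1, h2⟩ := hroot v hv hp
      rw [hκC v (.inr hp), hκC _ (.inr h1)] at hc
      exact ⟨hp, eq_one_of_cycleColor_eq hD h2 (Fin.mk.inj hc)⟩
    · exact absurd hc (hκB v (by tauto) _ (by simp [B]))
  have hfiber : ∀ v w, v ≠ r → w ≠ r → φ v = φ w → p v = φ v → p w = p (φ w) → κ v ≠ κ w := by
    intro v w hv hw h1 h2 h3
    have hn := hφ.ne_root v hv
    refine hκB v (by rw [h2]; tauto) w ?_
    have h4 := h.depth v hv
    have h5 := h.depth w hw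
    have h6 := h.depth _ hn
    rw [h2] at h4
    rw [h3, ← h1] at h5
    simp only [B, Finset.mem_union, Finset.mem_filter, Finset.mem_univ, true_and]
    exact .inr ⟨hw, h1.symm, by omega⟩
  refine ⟨κ, fun v hv => ?_, fun v w hv hw hvw h1 => ?_, fun v w hv hw h1 h2 => ?_⟩
  · by_cases hp : p v = r
    · obtain ⟨h1, h2⟩ := hroot v hv hp
      obtain ⟨h3, h4⟩ := hroot _ (hφ.ne_root v hv) h1
      rw [hκC v (.inr hp), hκC _ (.inr h3)]
      exact fun hc => cycleColor_ne hD h2 h4 (Fin.mk.inj hc)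
    · exact hκB v (by tauto) _ (by simp [B])
  · rcases hφ.parent_or_sibling v hv with h2 | ⟨h2, -⟩ <;>
      rcases hφ.parent_or_sibling w hw with h3 | ⟨h3, -⟩
    · exact absurd (hφ.inj v w hv hw h1 (by rw [h2, h3, h1])) hvw
    · exact hfiber v w hv hw h1 h2 h3
    · exact (hfiber w v hw hv h1.symm h3 h2).symm
    · exact absurd (hφ.inj v w hv hw h1 (by rw [h2, h3, h1])) hvw
  · obtain ⟨h3, h4⟩ := hmono v hv h1
    obtain ⟨h5, h6⟩ := hmono w hw h2
    exact hφ.root_inj v w hv hw h3 h5 (h4.trans h6.symm)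

/-- A tree on `n` vertices with a vertex of degree at least three has a rainbow separating path
system with `n - 1` members, for any number of colours from four on. -/
theorem rainbowSepNumber_le_of_three_le_degree {V : Type*} [Fintype V] [DecidableEq V]
    {T : SimpleGraph V} [DecidableRel T.Adj] (hT : T.IsTree) {r : V} (hr : 3 ≤ T.degree r) {k : ℕ}
    (hk : 4 ≤ k) : rainbowSepNumber T k ≤ Fintype.card V - 1 := by
  obtain ⟨p, δ, h⟩ := exists_isRooting hT r
  obtain ⟨D, φ, ρ, hD, hφ⟩ := h.exists_isPredecessor hr
  obtain ⟨κ, hκ2, hκf, hκm⟩ := hφ.exists_coloring h hD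
  have hex : ∀ u : {u // u ≠ r}, ∃ Q : GraphPath T,
      ∀ v, v ≠ r → (Q.HasEdge s(v, p v) ↔ v = u ∨ φ v = u) := fun u => hφ.exists_path h u.2
  choose Q hQ using hex
  let M : Multiset (GraphPath T × Fin k) :=
    (Finset.univ : Finset {u // u ≠ r}).val.map fun u => (Q u, Fin.castLE hk (κ u))
  have hM : ∀ u (hu : u ≠ r), (Q ⟨u, hu⟩, Fin.castLE hk (κ u)) ∈ M := fun u hu =>
    Multiset.mem_map.2 ⟨⟨u, hu⟩, Finset.mem_univ _, rfl⟩
  refine Nat.sInf_le ⟨M.map Prod.fst, ⟨M, rfl, fun e he f hf hef => ?_⟩, ?_⟩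
  swap
  · rw [Multiset.card_map, Multiset.card_map, Finset.card_val, Finset.card_univ,
      Fintype.card_subtype_compl, Fintype.card_subtype_eq]
  obtain ⟨v, hv, rfl⟩ := h.exists_edge_eq he
  obtain ⟨w, hw, rfl⟩ := h.exists_edge_eq hf
  have hvw : v ≠ w := by rintro rfl; exact hef rfl
  have hφv := hφ.ne_root v hv
  have hφw := hφ.ne_root w hw
  have hφne : ∀ x, x ≠ r → φ x ≠ x := by
    intro x hx h1
    rcases hφ.parent_or_sibling x hx with h2 | h2
    · exact (h.adj x hx).ne (h2.trans h1).symm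
    · exact h2.2 h1.symm
  suffices hs : ∃ x y, x ≠ r ∧ y ≠ r ∧ κ x ≠ κ y ∧ (v = x ∨ φ v = x) ∧ ¬ (w = x ∨ φ w = x) ∧
      (w = y ∨ φ w = y) ∧ ¬ (v = y ∨ φ v = y) by
    obtain ⟨x, y, hx, hy, hxy, h1, h2, h3, h4⟩ := hs
    refine ⟨_, hM x hx, _, hM y hy, fun hc => hxy (Fin.castLE_injective hk hc), ?_, ?_⟩
    · exact ⟨(hQ ⟨x, hx⟩ v hv).2 h1, fun hc => h2 ((hQ ⟨x, hx⟩ w hw).1 hc)⟩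
    · exact ⟨(hQ ⟨y, hy⟩ w hw).2 h3, fun hc => h4 ((hQ ⟨y, hy⟩ v hv).1 hc)⟩
  by_cases h1 : φ v = w
  · subst h1
    have h2 := hκ2 v hv
    have h3 : φ (φ v) ≠ v := fun hc => h2 (by rw [hc])
    exact ⟨v, φ (φ v), hv, hφw, h2, .inl rfl, by tauto, .inr rfl,
      not_or.2 ⟨h3.symm, (hφne _ hw).symm⟩⟩
  by_cases h2 : φ w = v
  · subst h2
    have h2 := hκ2 w hw
    have h3 : φ (φ w) ≠ w := fun hc => h2 (by rw [hc])
    exact ⟨φ (φ w), w, hφv, hw, h2.symm, .inr rfl, not_or.2 ⟨h3.symm, (hφne _ hv).symm⟩,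
      .inl rfl, by tauto⟩
  by_cases h3 : φ v = φ w
  · exact ⟨v, w, hv, hw, hκf v w hv hw hvw h3, .inl rfl, not_or.2 ⟨hvw.symm, h2⟩, .inl rfl,
      not_or.2 ⟨hvw, h1⟩⟩
  have hx : ∀ x, (v = x ∨ φ v = x) → ¬ (w = x ∨ φ w = x) := by
    rintro x (rfl | rfl) (h4 | h4)
    exacts [hvw h4.symm, h2 h4, h1 h4.symm, h3 h4.symm]
  by_contra hcon
  push Not at hcon
  have hall : ∀ x y, x ≠ r → y ≠ r → (v = x ∨ φ v = x) → (w = y ∨ φ w = y) → κ x = κ y := by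
    intro x y hxr hyr h4 h5
    by_contra hne
    exact hx y (hcon x y hxr hyr hne h4 (not_or.1 (hx x h4)) h5) h5
  have a1 := hall v w hv hw (.inl rfl) (.inl rfl)
  have a2 := hall v (φ w) hv hφw (.inl rfl) (.inr rfl)
  have a3 := hall (φ v) w hφv hw (.inr rfl) (.inl rfl)
  exact hvw (hκm v w hv hw (a1.trans a3.symm) (a1.symm.trans a2))

end RainbowSep

open RainbowSep Filter Asymptotics in
theorem mainTheorem4 :
    (∀ (V : Type*) [Fintype V] (T : SimpleGraph V), T.IsTree → ¬ IsPathGraph T →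
      ∀ k : ℕ, 4 ≤ k → rainbowSepNumber T k ≤ Fintype.card V - 1) ∧
    (∀ (ι : Type*) (V : ι → Type*) [∀ i, Fintype (V i)] (T : ∀ i, SimpleGraph (V i)),
      IsPathyTreeClass T →
      ∃ g : ℕ → ℝ, g =o[atTop] (fun n : ℕ => (n : ℝ)) ∧
        ∀ k : ℕ, 4 ≤ k → ∀ i,
          ((Fintype.card (V i) : ℝ) - 1) - g (Fintype.card (V i)) ≤ (rainbowSepNumber (T i) k : ℝ)) := by
  refine ⟨fun V _ T hT hpath k hk => ?_, fun ι V _ T hT => ?_⟩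
  · classical
    obtain ⟨r, hr⟩ : ∃ r, 3 ≤ T.degree r := by
      by_contra hcon
      push Not at hcon
      exact hpath (isPathGraph_of_degree_le_two hT fun v => Nat.lt_succ_iff.1 (hcon v))
    exact rainbowSepNumber_le_of_three_le_degree hT hr hk
  · obtain ⟨htree, b, hb, hbT⟩ := hT
    refine ⟨fun n => b n + 1, hb.add ?_, fun k hk i => ?_⟩
    · exact (isLittleO_const_left.2 <| .inr <|
        tendsto_norm_atTop_atTop.comp tendsto_natCast_atTop_atTop)
    · have h1 := card_le_rainbowSepNumber_add (htree i) (by omega : 2 ≤ k)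
      have h2 := hbT i
      have h3 : (Fintype.card (V i) : ℝ) ≤
          rainbowSepNumber (T i) k + numBranchVertices (T i) + 2 := by exact_mod_cast h1
      linarith
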